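/- Let $d\ge 1$ be an integer and equip $\mathbb{R}^d$ with the norm $\|x\|_\infty=\max_{1\le i\le d}|x_i|$; let $B(x,r)=\{y:\|x-y\|_\infty\le r\}$ denote the closed ball. For $x\in\mathbb{R}^d$, $0<r<1$ and $\delta\ge 1$ put $A(x,r,\delta)=B(x,r)\setminus B(x,r-r^\delta)$. For a Borel probability measure $\mu$ on $\mathbb{R}^d$ and $\eta\in(0,1)$, let $E_\mu(\delta,\eta)$ be the set of all $x\in\mathbb{R}^d$ for which there is a sequence $(r_n)_{n\ge1}$ in $(0,1)$ with $r_n\to 0$ and $$\mu\big(A(x,r_n,\delta)\big)\ \ge\ \eta\,\mu\big(B(x,r_n)\big)\qquad\text{for all } n.$$ The lower and upper dimensions of $\mu$ are $$\underline{\dim}(\mu)=\sup\{\alpha\ge 0:\ \text{for } \mu\text{-a.e. } x\ \exists r_x>0\ \forall\, 0<r<r_x,\ \mu(B(x,r))\le r^\alpha\},$$ $$\overline{\dim}(\mu)=\inf\{\beta\ge 0:\ \text{for } \mu\text{-a.e. } x\ \exists r_x>0\ \forall\, 0<r<r_x,\ \mu(B(x,r))\ge r^\beta\}.$$ **Theorem.**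 For all real numbers $d_*,d^*$ with $d-1<d_*<d^*<d$ and every $\eta\in(0,1)$, there exists a probability measure $\mu$ on $\mathbb{R}^d$ such that $\underline{\dim}(\mu)=d_*$, $\overline{\dim}(\mu)=d^*$, and $$\mu\left(E_\mu\left(\frac{d^*-(d-1)}{d_*-(d-1)},\,\eta\right)\right)=1.$$ -/

import Mathlib

open Set Filter Topology MeasureTheory
open scoped ENNReal

noncomputable section

/-- The annulus `A(x,r,δ) = B(x,r) \ B(x,r - r^δ)`, where `B` denotes closed balls of the ambient
metric (on `Fin d → ℝ` this is the metric of the sup norm). -/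
def annulus {X : Type*} [MetricSpace X] (x : X) (r δ : ℝ) : Set X :=
  Metric.closedBall x r \ Metric.closedBall x (r - r ^ δ)

/-- The property `P_μ(x,r,δ,η)`: the annulus carries at least the proportion `η` of the mass of
the ball. -/
def AnnulusCharged {X : Type*} [MetricSpace X] [MeasurableSpace X] (μ : Measure X)
    (x : X) (r δ η : ℝ) : Prop :=
  ENNReal.ofReal η * μ (Metric.closedBall x r) ≤ μ (annulus x r δ)

/-- The set `E_μ(δ,η)` of the points `x` such that `P_μ(x,r_n,δ,η)` holds along some sequence of
radii `r_n ∈ (0,1)` tending to `0`. -/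
def annulusSet {X : Type*} [MetricSpace X] [MeasurableSpace X] (μ : Measure X)
    (δ η : ℝ) : Set X :=
  {x | ∃ r : ℕ → ℝ, (∀ n, 0 < r n ∧ r n < 1) ∧ Tendsto r atTop (𝓝 0) ∧
    ∀ n, AnnulusCharged μ x (r n) δ η}

/-- The lower dimension of `μ`: the supremum (in `[-∞,∞]`) of the `α ≥ 0` such that, for
`μ`-a.e. `x`, `μ(B(x,r)) ≤ r^α` for all small `r > 0`. -/
def lowerDim {X : Type*} [MetricSpace X] [MeasurableSpace X] (μ : Measure X) : EReal :=
  sSup ((fun α : ℝ => (α : EReal)) '' {α : ℝ | 0 ≤ α ∧ ∀ᵐ x ∂μ, ∃ r₀ : ℝ, 0 < r₀ ∧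
    ∀ r : ℝ, 0 < r → r < r₀ → μ (Metric.closedBall x r) ≤ ENNReal.ofReal (r ^ α)})

/-- The upper dimension of `μ`: the infimum (in `[-∞,∞]`) of the `β ≥ 0` such that, for
`μ`-a.e. `x`, `μ(B(x,r)) ≥ r^β` for all small `r > 0`. -/
def upperDim {X : Type*} [MetricSpace X] [MeasurableSpace X] (μ : Measure X) : EReal :=
  sInf ((fun β : ℝ => (β : EReal)) '' {β : ℝ | 0 ≤ β ∧ ∀ᵐ x ∂μ, ∃ r₀ : ℝ, 0 < r₀ ∧
    ∀ r : ℝ, 0 < r → r < r₀ → ENNReal.ofReal (r ^ β) ≤ μ (Metric.closedBall x r)})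

end

/-!
Let `a = dl - (d - 1)` and `b = du - (d - 1)`, so that `0 < a < b < 1`. The measure is the product of
a measure `ν` on the first axis, of dimensions `a` and `b`, with Lebesgue measure on the unit cube of
the other axes. For the sup norm, balls are products of intervals; hence the Lebesgue factor multiplies
the mass of a ball of radius `r` by `r ^ (d - 1)` up to a constant, and an annulus contains the product
of a one-dimensional annulus with a ball (`AnnulusCharged.prodUnitCube`).

The measure `ν` lives on a Cantor set in which each interval has `D` children, all of the same mass,
where `D` is so large that `η ≤ 1 - 1 / D`. While the mass `D⁻ᵏ` of an interval of generation `k` exceeds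
the `b`-th power of its length `L`, it is divided into `D` equal parts; the local dimension then moves
towards `b`. When the mass has dropped to `L ^ b`, a gap is made: with `r = L / 3`, the children have
length `r ^ (b / a) / (2 D)`, so that the `a`-th power of their length is comparable to their mass. One
child is put right after the first third of the interval and the others at the end of the second third.
The mass thus stays between constant multiples of `L ^ b` and of `L ^ a` (`GapParams.len_rpow_b_le`,
`GapParams.mass_le`), and both bounds are attained infinitely often; this gives the dimensions.

From a point of the isolated child all the other children lie at distance between `r - r ^ (b / a)` and
`r`, and the ball of radius `r` meets no other interval; so the annulus carries the proportion
`1 - 1 / D` of the mass of the ball (`GapParams.annulusCharged`). The choices of children are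
independent, so almost every point lies in the isolated child at infinitely many of the gaps
(`frequently_digit_eq_zero`).
-/

open Set Filter Topology MeasureTheory
open scoped ENNReal

/-! ### Homogeneous Cantor schemes -/

/-- Data for a Cantor-type construction on the line in which every interval of generation `k`,
of length `len k`, contains `D` intervals of generation `k + 1`; the `i`-th one starts at distance
`pos k i` from the left endpoint of its parent. Siblings may touch but do not overlap. -/
structure CantorScheme (D : ℕ) where
  /-- The common length of the intervals of generation `k`. -/
  len : ℕ → ℝ
  /-- The offset of the `i`-th child inside an interval of generation `k`. -/
  pos : ℕ → Fin D → ℝ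
  len_pos : ∀ k, 0 < len k
  pos_nonneg : ∀ k i, 0 ≤ pos k i
  pos_add_len_le : ∀ k i, pos k i + len (k + 1) ≤ len k
  len_le_dist : ∀ k i j, i ≠ j → len (k + 1) ≤ |pos k i - pos k j|

namespace CantorScheme

variable {D : ℕ} (c : CantorScheme D)

/-- The left endpoint of the interval of generation `k` with address `(ω 0, …, ω (k - 1))`. -/
def start (k : ℕ) (ω : ℕ → Fin D) : ℝ := ∑ i ∈ Finset.range k, c.pos i (ω i)

/-- The point of the Cantor set with address `ω`: the supremum of the left endpoints of the nested
intervals. -/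
noncomputable def point (ω : ℕ → Fin D) : ℝ := ⨆ k, c.start k ω

lemma start_succ (k : ℕ) (ω : ℕ → Fin D) : c.start (k + 1) ω = c.start k ω + c.pos k (ω k) := by
  simp [start, Finset.sum_range_succ]

lemma start_congr {k : ℕ} {ω ω' : ℕ → Fin D} (h : ∀ i < k, ω i = ω' i) :
    c.start k ω = c.start k ω' :=
  Finset.sum_congr rfl fun i hi => by rw [h i (Finset.mem_range.1 hi)]

lemma monotone_start (ω : ℕ → Fin D) : Monotone fun k => c.start k ω :=
  monotone_nat_of_le_succ fun k => by
    rw [start_succ]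
    linarith [c.pos_nonneg k (ω k)]

lemma antitone_start_add_len (ω : ℕ → Fin D) : Antitone fun k => c.start k ω + c.len k :=
  antitone_nat_of_succ_le fun k => by
    rw [start_succ]
    linarith [c.pos_add_len_le k (ω k)]

lemma start_le_start_add_len (j k : ℕ) (ω : ℕ → Fin D) :
    c.start j ω ≤ c.start k ω + c.len k := by
  rcases le_total j k with h | h
  · linarith [c.monotone_start ω h, c.len_pos k]
  · have := c.antitone_start_add_len ω h
    simp only at this
    linarith [c.len_pos j]

lemma start_le_point (k : ℕ) (ω : ℕ → Fin D) : c.start k ω ≤ c.point ω :=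
  le_ciSup (f := fun k => c.start k ω)
    ⟨c.start 0 ω + c.len 0, by rintro _ ⟨j, rfl⟩; exact c.start_le_start_add_len j 0 ω⟩ k

lemma point_le_start_add_len (k : ℕ) (ω : ℕ → Fin D) : c.point ω ≤ c.start k ω + c.len k :=
  ciSup_le fun j => c.start_le_start_add_len j k ω

/-- Intervals of the same generation with different addresses do not overlap. -/
lemma len_le_dist_start {k : ℕ} {ω ω' : ℕ → Fin D} (h : ∃ i < k, ω i ≠ ω' i) :
    c.len k ≤ |c.start k ω - c.start k ω'| := by
  induction k with
  | zero => simp at h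
  | succ k ih =>
    rw [start_succ, start_succ]
    by_cases h' : ∃ i < k, ω i ≠ ω' i
    · have h1 := ih h'
      have a1 := c.pos_nonneg k (ω k)
      have a2 := c.pos_nonneg k (ω' k)
      have b1 := c.pos_add_len_le k (ω k)
      have b2 := c.pos_add_len_le k (ω' k)
      rcases le_abs.1 h1 with h2 | h2
      · exact le_abs.2 (Or.inl (by linarith))
      · exact le_abs.2 (Or.inr (by linarith))
    · have h2 : ∀ i < k, ω i = ω' i := by
        intro i hi
        by_contra hne
        exact h' ⟨i, hi, hne⟩
      obtain ⟨i, hi, hne⟩ := h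
      have hik : i = k := by
        by_contra hik
        exact hne (h2 i (by omega))
      subst hik
      rw [c.start_congr h2, add_sub_add_left_eq_sub]
      exact c.len_le_dist i _ _ hne

lemma measurable_start (k : ℕ) : Measurable (c.start k) := by
  unfold start
  refine Finset.measurable_sum _ fun i _ => ?_
  exact (measurable_of_countable (c.pos i)).comp (measurable_pi_apply i)

lemma measurable_point : Measurable c.point :=
  Measurable.iSup c.measurable_start

end CantorScheme

/-! ### Independent uniform digits -/

section Coding

variable (D : ℕ) [NeZero D]

/-- The law of a sequence of independent uniformly distributed digits in `Fin D`. -/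
noncomputable def digitMeasure : Measure (ℕ → Fin D) :=
  Measure.infinitePi fun _ => (PMF.uniformOfFintype (Fin D)).toMeasure

instance : IsProbabilityMeasure (digitMeasure D) := by
  unfold digitMeasure
  infer_instance

lemma natCast_inv_pow_eq_ofReal (k : ℕ) :
    ((D : ℝ≥0∞)⁻¹) ^ k = ENNReal.ofReal (((D : ℝ)⁻¹) ^ k) := by
  have hD : (0 : ℝ) < D := by exact_mod_cast Nat.pos_of_ne_zero (NeZero.ne D)
  rw [ENNReal.ofReal_pow (by positivity), ENNReal.ofReal_inv_of_pos hD, ENNReal.ofReal_natCast]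

variable {D}

lemma digitMeasure_cylinder (k : ℕ) (ω : ℕ → Fin D) :
    digitMeasure D {ω' | ∀ i < k, ω' i = ω i} = ENNReal.ofReal (((D : ℝ)⁻¹) ^ k) := by
  have h : {ω' : ℕ → Fin D | ∀ i < k, ω' i = ω i}
      = Set.pi (Finset.range k : Finset ℕ) fun i => {ω i} := by
    ext ω'
    simp
  rw [h, digitMeasure, Measure.infinitePi_pi _ fun i _ => measurableSet_singleton _]
  rw [← natCast_inv_pow_eq_ofReal]
  simp

/-- A set of addresses that all agree on their first `k` digits lies in a single cylinder. No
measurability is needed, so that this applies to arbitrary fibres. -/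
lemma digitMeasure_le_of_agree {k : ℕ} {s : Set (ℕ → Fin D)}
    (h : ∀ ω ∈ s, ∀ ω' ∈ s, ∀ i < k, ω i = ω' i) :
    digitMeasure D s ≤ ENNReal.ofReal (((D : ℝ)⁻¹) ^ k) := by
  rcases s.eq_empty_or_nonempty with rfl | ⟨ω, hω⟩
  · simp
  · rw [← digitMeasure_cylinder k ω]
    exact measure_mono fun ω' hω' => h ω' hω' ω hω

/-- Along any infinite set of times, the digit `0` almost surely occurs infinitely often. -/
lemma frequently_digit_eq_zero {p : ℕ → Prop} (hp : ∃ᶠ k in atTop, p k) :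
    ∀ᵐ ω ∂(digitMeasure D), ∃ᶠ k in atTop, p k ∧ ω k = 0 := by
  have key : ∀ N : ℕ, digitMeasure D {ω | ∀ k ≥ N, ¬ (p k ∧ ω k = 0)} = 0 := by
    intro N
    have hp' : ∃ᶠ k in atTop, N ≤ k ∧ p k :=
      (hp.and_eventually (eventually_ge_atTop N)).mono fun k hk => ⟨hk.2, hk.1⟩
    -- Missing the digit `0` at `m` prescribed times has probability `q ^ m`.
    obtain ⟨φ, hφ, hφp⟩ := extraction_of_frequently_atTop hp'
    set q : ℝ≥0∞ := (PMF.uniformOfFintype (Fin D)).toMeasure {0}ᶜ with hq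
    have hq1 : q < 1 := by
      rw [hq, prob_compl_eq_one_sub (measurableSet_singleton _),
        PMF.toMeasure_apply_singleton _ _ (measurableSet_singleton _)]
      refine ENNReal.sub_lt_self (by simp) (by simp) ?_
      simp
    have hle : ∀ m : ℕ, digitMeasure D {ω | ∀ k ≥ N, ¬ (p k ∧ ω k = 0)} ≤ q ^ m := by
      intro m
      have hsub : {ω : ℕ → Fin D | ∀ k ≥ N, ¬ (p k ∧ ω k = 0)} ⊆
          Set.pi ((Finset.range m).image φ : Finset ℕ) fun _ => ({0}ᶜ : Set (Fin D)) := by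
        intro ω hω i hi
        simp only [Finset.coe_image, Set.mem_image] at hi
        obtain ⟨n, -, rfl⟩ := hi
        exact fun h0 => hω (φ n) (hφp n).1 ⟨(hφp n).2, h0⟩
      refine (measure_mono hsub).trans_eq ?_
      rw [digitMeasure, Measure.infinitePi_pi _ fun i _ => (measurableSet_singleton _).compl,
        Finset.prod_const, Finset.card_image_of_injective _ hφ.injective, Finset.card_range]
    exact le_antisymm (ge_of_tendsto' (ENNReal.tendsto_pow_atTop_nhds_zero_of_lt_one hq1) hle)
      zero_le
  have h2 : ∀ᵐ ω ∂(digitMeasure D), ∀ N : ℕ, ∃ k ≥ N, p k ∧ ω k = 0 := by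
    rw [ae_all_iff]
    intro N
    rw [ae_iff, ← key N]
    congr 1
    ext ω
    simp
  filter_upwards [h2] with ω hω
  exact frequently_atTop.2 hω

end Coding

/-! ### The natural measure of a Cantor scheme -/

namespace CantorScheme

variable {D : ℕ} [NeZero D] (c : CantorScheme D)

/-- The natural measure of the scheme, giving mass `D⁻ᵏ` to each interval of generation `k`. -/
noncomputable def measure : Measure ℝ := (digitMeasure D).map c.point

instance : IsProbabilityMeasure c.measure :=
  Measure.isProbabilityMeasure_map c.measurable_point.aemeasurable

lemma measure_apply {s : Set ℝ} (hs : MeasurableSet s) :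
    c.measure s = digitMeasure D (c.point ⁻¹' s) :=
  Measure.map_apply c.measurable_point hs

lemma ae_measure_iff {p : ℝ → Prop} (hp : MeasurableSet {x | p x}) :
    (∀ᵐ x ∂c.measure, p x) ↔ ∀ᵐ ω ∂(digitMeasure D), p (c.point ω) :=
  ae_map_iff c.measurable_point.aemeasurable hp

/-- A ball of radius at most `len k` meets at most four intervals of generation `k`. -/
lemma measure_closedBall_le {k : ℕ} {s : ℝ} (hs : s ≤ c.len k) (x : ℝ) :
    c.measure (Metric.closedBall x s) ≤ ENNReal.ofReal (4 * ((D : ℝ)⁻¹) ^ k) := by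
  have hL := c.len_pos k
  rw [c.measure_apply Metric.isClosed_closedBall.measurableSet]
  -- The left endpoints of distinct intervals are `len k` apart, so rounding separates them.
  let f : (ℕ → Fin D) → ℤ := fun ω => ⌊(c.start k ω - x) / c.len k⌋
  have hsub : c.point ⁻¹' Metric.closedBall x s ⊆ ⋃ v ∈ Finset.Icc (-2 : ℤ) 1, f ⁻¹' {v} := by
    intro ω hω
    have h1 := c.start_le_point k ω
    have h2 := c.point_le_start_add_len k ω
    rw [mem_preimage, Metric.mem_closedBall, Real.dist_eq, abs_le] at hω
    simp only [mem_iUnion, mem_preimage, mem_singleton_iff, exists_prop, exists_eq_right',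
      Finset.mem_Icc, f]
    constructor
    · rw [Int.le_floor, le_div_iff₀ hL]
      push_cast
      linarith
    · rw [← Int.lt_add_one_iff, Int.floor_lt, div_lt_iff₀ hL]
      push_cast
      linarith
  have hfib : ∀ v : ℤ, digitMeasure D (f ⁻¹' {v}) ≤ ENNReal.ofReal (((D : ℝ)⁻¹) ^ k) := by
    intro v
    refine digitMeasure_le_of_agree fun ω hω ω' hω' i hi => ?_
    by_contra hne
    have hd := c.len_le_dist_start ⟨i, hi, hne⟩
    have hf : ⌊(c.start k ω - x) / c.len k⌋ = ⌊(c.start k ω' - x) / c.len k⌋ :=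
      Eq.trans hω (Eq.symm hω')
    have h3 := Int.abs_sub_lt_one_of_floor_eq_floor hf
    rw [← sub_div, sub_sub_sub_cancel_right, abs_div, abs_of_pos hL, div_lt_one hL] at h3
    linarith
  calc _ ≤ digitMeasure D (⋃ v ∈ Finset.Icc (-2 : ℤ) 1, f ⁻¹' {v}) := measure_mono hsub
    _ ≤ ∑ v ∈ Finset.Icc (-2 : ℤ) 1, digitMeasure D (f ⁻¹' {v}) := measure_biUnion_finset_le _ _
    _ ≤ ∑ v ∈ Finset.Icc (-2 : ℤ) 1, ENNReal.ofReal (((D : ℝ)⁻¹) ^ k) :=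
        Finset.sum_le_sum fun v _ => hfib v
    _ = _ := by
        rw [Finset.sum_const, ENNReal.ofReal_mul (by norm_num)]
        simp

/-- A ball of radius at least `len k` around a point of the Cantor set contains an interval of
generation `k`. -/
lemma le_measure_closedBall {k : ℕ} {s : ℝ} (hs : c.len k ≤ s) (ω : ℕ → Fin D) :
    ENNReal.ofReal (((D : ℝ)⁻¹) ^ k) ≤ c.measure (Metric.closedBall (c.point ω) s) := by
  rw [c.measure_apply Metric.isClosed_closedBall.measurableSet, ← digitMeasure_cylinder k ω]
  refine measure_mono fun ω' hω' => ?_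
  have h1 := c.start_le_point k ω
  have h2 := c.point_le_start_add_len k ω
  have h3 := c.start_le_point k ω'
  have h4 := c.point_le_start_add_len k ω'
  rw [c.start_congr hω'] at h3 h4
  rw [mem_preimage, Metric.mem_closedBall, Real.dist_eq, abs_le]
  constructor <;> linarith

/-- Only one interval of generation `k` meets the interior of a given interval of generation `k`. -/
lemma measure_le_of_subset_Ioo {k : ℕ} (ω : ℕ → Fin D) {s : Set ℝ} (hs : MeasurableSet s)
    (h : s ⊆ Ioo (c.start k ω) (c.start k ω + c.len k)) :
    c.measure s ≤ ENNReal.ofReal (((D : ℝ)⁻¹) ^ k) := by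
  rw [c.measure_apply hs, ← digitMeasure_cylinder k ω]
  refine measure_mono fun ω' hω' i hi => ?_
  by_contra hne
  have hd := c.len_le_dist_start ⟨i, hi, hne⟩
  have h3 := c.start_le_point k ω'
  have h4 := c.point_le_start_add_len k ω'
  have h5 := h hω'
  rw [mem_Ioo] at h5
  rcases le_abs.1 hd with h6 | h6 <;> linarith

/-- If `s` contains all the children, except possibly the `0`-th, of an interval of generation `k`,
then it carries the proportion `1 - 1 / D` of its mass. -/
lemma le_measure_of_children_subset {k : ℕ} (ω : ℕ → Fin D) {s : Set ℝ} (hs : MeasurableSet s)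
    (h : ∀ i : Fin D, i ≠ 0 → Icc (c.start k ω + c.pos k i)
      (c.start k ω + c.pos k i + c.len (k + 1)) ⊆ s) :
    ENNReal.ofReal ((1 - (D : ℝ)⁻¹) * ((D : ℝ)⁻¹) ^ k) ≤ c.measure s := by
  have hsub : {ω' : ℕ → Fin D | ∀ i < k, ω' i = ω i} \
      {ω' | ∀ i < k + 1, ω' i = Function.update ω k 0 i} ⊆ c.point ⁻¹' s := by
    rintro ω' ⟨h1, h2⟩
    have h1 : ∀ i < k, ω' i = ω i := h1
    have hk : ω' k ≠ 0 := by
      intro h0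
      refine h2 fun i hi => ?_
      rcases Nat.lt_succ_iff_lt_or_eq.1 hi with hi | rfl
      · rw [Function.update_of_ne hi.ne, h1 i hi]
      · rw [Function.update_self, h0]
    refine h _ hk ?_
    have h3 := c.start_le_point (k + 1) ω'
    have h4 := c.point_le_start_add_len (k + 1) ω'
    rw [start_succ, c.start_congr h1] at h3 h4
    exact ⟨h3, h4⟩
  rw [c.measure_apply hs]
  refine le_trans ?_ (measure_mono hsub)
  refine le_trans ?_ le_measure_sdiff
  rw [digitMeasure_cylinder, digitMeasure_cylinder, ← ENNReal.ofReal_sub _ (by positivity)]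
  refine (congrArg ENNReal.ofReal ?_).le
  ring

end CantorScheme

/-! ### The one-dimensional measure -/

/-- Parameters of the one-dimensional construction: the branching number `D`, the two prescribed
dimensions `a < b` and the length `l` of the initial interval, which has to be small. -/
structure GapParams where
  /-- The branching number. -/
  D : ℕ
  /-- The lower dimension. -/
  a : ℝ
  /-- The upper dimension. -/
  b : ℝ
  /-- The initial length. -/
  l : ℝ
  two_le_D : 2 ≤ D
  a_pos : 0 < a
  a_lt_b : a < b
  b_lt_one : b < 1
  l_pos : 0 < l
  l_le_one : l ≤ 1
  /-- Making a gap inside an interval of length at most `l` divides the `b`-th power of its length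
  by at least `D`. -/
  l_small : D * (l ^ (b / a - 1)) ^ b ≤ 1

namespace GapParams

lemma exists_of_lt {a b : ℝ} (ha : 0 < a) (hab : a < b) (hb : b < 1) {D : ℕ} (hD : 2 ≤ D) :
    ∃ P : GapParams, P.a = a ∧ P.b = b ∧ P.D = D := by
  have hb0 : 0 < b := ha.trans hab
  have hδ : 0 < b / a - 1 := by rw [sub_pos, one_lt_div ha]; exact hab
  have hD2 : (2 : ℝ) ≤ D := by exact_mod_cast hD
  have hD0 : (0 : ℝ) < D := by linarith
  refine ⟨⟨D, a, b, ((D : ℝ)⁻¹) ^ (1 / ((b / a - 1) * b)), hD, ha, hab, hb, by positivity,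
    Real.rpow_le_one (by positivity) (inv_le_one_of_one_le₀ (by linarith)) (by positivity), ?_⟩,
    rfl, rfl, rfl⟩
  rw [← Real.rpow_mul (by positivity), ← Real.rpow_mul (by positivity),
    one_div_mul_cancel (by positivity), Real.rpow_one, mul_inv_cancel₀ hD0.ne']

variable (P : GapParams)

instance : NeZero P.D := ⟨by have := P.two_le_D; omega⟩

/-- The length of the intervals of generation `k`. As long as the mass `D⁻ᵏ` of an interval exceeds
the `b`-th power of its length, the interval is divided into `D` equal parts; otherwise its children
are so short that their mass is comparable to the `a`-th power of their length. -/
noncomputable def len : ℕ → ℝ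
  | 0 => P.l
  | k + 1 => if ((P.D : ℝ)⁻¹) ^ k ≤ len k ^ P.b then (len k / 3) ^ (P.b / P.a) / (2 * P.D)
      else len k / P.D

/-- The generations at which gaps are created: the mass of an interval has dropped to the `b`-th
power of its length. -/
def IsGap (k : ℕ) : Prop := ((P.D : ℝ)⁻¹) ^ k ≤ P.len k ^ P.b

lemma len_succ_of_isGap {k : ℕ} (h : P.IsGap k) :
    P.len (k + 1) = (P.len k / 3) ^ (P.b / P.a) / (2 * P.D) := by
  unfold IsGap at h
  rw [len, if_pos h]

lemma len_succ_of_not_isGap {k : ℕ} (h : ¬ P.IsGap k) : P.len (k + 1) = P.len k / P.D := by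
  unfold IsGap at h
  rw [len, if_neg h]

lemma two_le_D_real : (2 : ℝ) ≤ P.D := by exact_mod_cast P.two_le_D

lemma D_pos : (0 : ℝ) < P.D := by linarith [P.two_le_D_real]

lemma b_pos : 0 < P.b := P.a_pos.trans P.a_lt_b

lemma one_lt_b_div_a : 1 < P.b / P.a := (one_lt_div P.a_pos).2 P.a_lt_b

lemma len_pos (k : ℕ) : 0 < P.len k := by
  have hD := P.D_pos
  induction k with
  | zero => exact P.l_pos
  | succ k ih =>
    rw [len]
    split_ifs <;> positivity

lemma len_succ_of_isGap_le {k : ℕ} (h : P.IsGap k) (h1 : P.len k ≤ 1) :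
    2 * P.D * P.len (k + 1) ≤ P.len k / 3 := by
  have hD := P.D_pos
  have hL := P.len_pos k
  rw [P.len_succ_of_isGap h, mul_div_cancel₀ _ (by positivity)]
  calc (P.len k / 3) ^ (P.b / P.a) ≤ (P.len k / 3) ^ (1 : ℝ) :=
        Real.rpow_le_rpow_of_exponent_ge (by positivity) (by linarith) P.one_lt_b_div_a.le
    _ = _ := Real.rpow_one _

lemma len_le_l_mul (k : ℕ) : P.len k ≤ P.l * (1 / 2) ^ k := by
  induction k with
  | zero => simp [len]
  | succ k ih =>
    have hD := P.two_le_D_real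
    have hL := P.len_pos k
    have hL' := P.len_pos (k + 1)
    have h1 : P.len k ≤ 1 := by
      refine ih.trans (mul_le_one₀ P.l_le_one (by positivity) ?_)
      exact pow_le_one₀ (by norm_num) (by norm_num)
    have h2 : P.len (k + 1) ≤ P.len k / 2 := by
      by_cases h : P.IsGap k
      · have := P.len_succ_of_isGap_le h h1
        nlinarith
      · rw [P.len_succ_of_not_isGap h]
        gcongr
    rw [pow_succ]
    linarith

lemma len_le_l (k : ℕ) : P.len k ≤ P.l :=
  (P.len_le_l_mul k).trans
    (mul_le_of_le_one_right P.l_pos.le (pow_le_one₀ (by norm_num) (by norm_num)))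

lemma len_le_one (k : ℕ) : P.len k ≤ 1 := (P.len_le_l k).trans P.l_le_one

lemma tendsto_len : Tendsto P.len atTop (𝓝[>] 0) := by
  refine tendsto_nhdsWithin_iff.2 ⟨?_, Eventually.of_forall P.len_pos⟩
  have h : Tendsto (fun k : ℕ => P.l * (1 / 2 : ℝ) ^ k) atTop (𝓝 (P.l * 0)) :=
    (tendsto_pow_atTop_nhds_zero_of_lt_one (by norm_num) (by norm_num)).const_mul _
  rw [mul_zero] at h
  exact squeeze_zero (fun k => (P.len_pos k).le) P.len_le_l_mul h

/-- The mass of an interval is at least comparable to the `b`-th power of its length: equal division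
stops once this bound is attained, and a gap restores it because the children are very short. -/
lemma len_rpow_b_le (k : ℕ) : P.len k ^ P.b ≤ P.D * ((P.D : ℝ)⁻¹) ^ k := by
  have hD := P.D_pos
  have hb := P.b_pos
  have hδ := P.one_lt_b_div_a
  induction k with
  | zero =>
    have := Real.rpow_le_one (P.len_pos 0).le (P.len_le_one 0) hb.le
    have := P.two_le_D_real
    rw [pow_zero]
    linarith
  | succ k ih =>
    have hL := P.len_pos k
    rw [pow_succ', mul_inv_cancel_left₀ hD.ne']
    by_cases h : P.IsGap k
    · have h1 : P.len (k + 1) ≤ P.len k * P.len k ^ (P.b / P.a - 1) := by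
        rw [P.len_succ_of_isGap h]
        calc _ ≤ (P.len k / 3) ^ (P.b / P.a) :=
              div_le_self (by positivity) (by linarith [P.two_le_D_real])
          _ ≤ P.len k ^ (P.b / P.a) := by gcongr; linarith
          _ = P.len k ^ (1 + (P.b / P.a - 1)) := by rw [add_sub_cancel]
          _ = _ := by rw [Real.rpow_add hL, Real.rpow_one]
      have h2 : P.D * (P.len k ^ (P.b / P.a - 1)) ^ P.b ≤ 1 := by
        have h0 : 0 ≤ P.b / P.a - 1 := by linarith
        refine le_trans ?_ P.l_small
        gcongr
        exact P.len_le_l k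
      have h3 : P.D * P.len (k + 1) ^ P.b ≤ P.len k ^ P.b := by
        calc P.D * P.len (k + 1) ^ P.b
            ≤ P.D * (P.len k * P.len k ^ (P.b / P.a - 1)) ^ P.b := by
              gcongr
              exact (P.len_pos _).le
          _ = P.len k ^ P.b * (P.D * (P.len k ^ (P.b / P.a - 1)) ^ P.b) := by
              rw [Real.mul_rpow hL.le (by positivity)]
              ring
          _ ≤ P.len k ^ P.b := mul_le_of_le_one_right (by positivity) h2
      exact le_of_mul_le_mul_left (h3.trans ih) hD
    · have h1 : ((P.D : ℝ)⁻¹) ^ k > P.len k ^ P.b := not_le.1 h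
      refine le_trans ?_ h1.le
      have := P.len_pos (k + 1)
      gcongr
      rw [P.len_succ_of_not_isGap h]
      exact div_le_self hL.le (by linarith [P.two_le_D_real])

lemma len_succ_rpow_a {k : ℕ} (h : P.IsGap k) :
    P.len (k + 1) ^ P.a = (P.len k / 3) ^ P.b / (2 * P.D) ^ P.a := by
  have hD := P.D_pos
  have hL := P.len_pos k
  rw [P.len_succ_of_isGap h, Real.div_rpow (by positivity) (by positivity),
    ← Real.rpow_mul (by positivity), div_mul_cancel₀ _ P.a_pos.ne']

/-- A constant bounding the ratio of the mass of an interval to the `a`-th power of its length. -/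
noncomputable def bound : ℝ := 6 * P.D / P.l ^ P.a

lemma bound_pos : 0 < P.bound := by
  have := P.D_pos
  have := P.l_pos
  unfold bound
  positivity

/-- The mass of an interval is at most comparable to the `a`-th power of its length. Equal division
improves the bound since `a < 1`; a gap starts from mass at most `len k ^ b`, and the exponent `b / a`
turns this into the `a`-th power of the new length. -/
lemma mass_le (k : ℕ) : ((P.D : ℝ)⁻¹) ^ k ≤ P.bound * P.len k ^ P.a := by
  have hD := P.D_pos
  have hD2 := P.two_le_D_real
  have ha := P.a_pos
  have ha1 : P.a ≤ 1 := (P.a_lt_b.trans P.b_lt_one).le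
  have hC := P.bound_pos
  have hl := P.l_pos
  induction k with
  | zero =>
    have : P.bound * P.len 0 ^ P.a = 6 * P.D := by
      rw [bound, len, div_mul_cancel₀ _ (by positivity)]
    rw [this, pow_zero]
    linarith
  | succ k ih =>
    have hL := P.len_pos k
    by_cases h : P.IsGap k
    · have h1 : (2 * P.D : ℝ) ^ P.a ≤ 2 * P.D :=
        (Real.rpow_le_rpow_of_exponent_le (by linarith) ha1).trans_eq (Real.rpow_one _)
      have h2 : (3 : ℝ) ^ P.b ≤ 3 :=
        (Real.rpow_le_rpow_of_exponent_le (by norm_num) P.b_lt_one.le).trans_eq (Real.rpow_one _)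
      have h3 : (3 : ℝ) ^ P.b * (2 * P.D) ^ P.a ≤ P.bound := by
        calc (3 : ℝ) ^ P.b * (2 * P.D) ^ P.a ≤ 3 * (2 * P.D) := by gcongr
          _ = 6 * P.D := by ring
          _ ≤ P.bound := by
              rw [bound, le_div_iff₀ (by positivity)]
              exact mul_le_of_le_one_right (by positivity)
                (Real.rpow_le_one hl.le P.l_le_one ha.le)
      rw [P.len_succ_rpow_a h, Real.div_rpow hL.le (by norm_num), div_div, mul_div_assoc',
        le_div_iff₀ (by positivity), pow_succ]
      have h4 : ((P.D : ℝ)⁻¹) ^ k * (P.D : ℝ)⁻¹ ≤ P.len k ^ P.b :=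
        (mul_le_of_le_one_right (by positivity) (inv_le_one_of_one_le₀ (by linarith))).trans h
      calc _ ≤ P.len k ^ P.b * P.bound := by gcongr
        _ = _ := mul_comm _ _
    · rw [P.len_succ_of_not_isGap h, Real.div_rpow hL.le hD.le, pow_succ, mul_div_assoc',
        ← div_eq_mul_inv]
      have h1 : (P.D : ℝ) ^ P.a ≤ P.D :=
        (Real.rpow_le_rpow_of_exponent_le (by linarith) ha1).trans_eq (Real.rpow_one _)
      gcongr

/-- During generations without gaps the mass decays faster than the `b`-th power of the length, so
that gaps are created again and again. -/
lemma frequently_isGap : ∃ᶠ k in atTop, P.IsGap k := by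
  rw [frequently_atTop]
  by_contra hcon
  push Not at hcon
  obtain ⟨N, hN⟩ := hcon
  have hD := P.D_pos
  have hL := P.len_pos N
  have hlen : ∀ j, P.len (N + j) = P.len N * ((P.D : ℝ)⁻¹) ^ j := by
    intro j
    induction j with
    | zero => simp
    | succ j ih =>
      rw [← add_assoc, P.len_succ_of_not_isGap (hN _ (by omega)), ih, pow_succ]
      ring
  set q : ℝ := (P.D : ℝ)⁻¹ with hq
  have hq0 : 0 < q := by positivity
  have hq1 : q < 1 := inv_lt_one_of_one_lt₀ (by linarith [P.two_le_D_real])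
  have hlt : ∀ j : ℕ, P.len N ^ P.b ≤ q ^ N * (q ^ (1 - P.b)) ^ j := by
    intro j
    have h1 : P.len (N + j) ^ P.b < q ^ (N + j) := not_le.1 (hN (N + j) (by omega))
    rw [hlen, Real.mul_rpow hL.le (by positivity)] at h1
    have h2 : (q ^ (1 - P.b)) ^ j * (q ^ j) ^ P.b = q ^ j := by
      rw [← Real.rpow_natCast, ← Real.rpow_natCast, ← Real.rpow_mul hq0.le, ← Real.rpow_mul hq0.le,
        ← Real.rpow_add hq0]
      congr 1
      ring
    have h3 : 0 < (q ^ j) ^ P.b := by positivity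
    refine le_of_mul_le_mul_right ?_ h3
    rw [mul_assoc, h2, ← pow_add]
    exact h1.le
  have hlim : Tendsto (fun j : ℕ => q ^ N * (q ^ (1 - P.b)) ^ j) atTop (𝓝 (q ^ N * 0)) :=
    (tendsto_pow_atTop_nhds_zero_of_lt_one (by positivity)
      (Real.rpow_lt_one hq0.le hq1 (by linarith [P.b_lt_one]))).const_mul _
  have := ge_of_tendsto' hlim hlt
  have h0 : 0 < P.len N ^ P.b := by positivity
  linarith

open Classical in
/-- The offsets of the children. In a generation with gaps the `0`-th child starts just after the
first third of its parent, and all others are packed against the end of the second third. -/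
noncomputable def pos (k : ℕ) (i : Fin P.D) : ℝ :=
  if P.IsGap k then
    if i = 0 then P.len k / 3 + P.len (k + 1) else 2 * (P.len k / 3) - i * P.len (k + 1)
  else i * P.len (k + 1)

/-- The Cantor scheme in which generations of equal division alternate with generations creating
gaps. -/
noncomputable def scheme : CantorScheme P.D where
  len := P.len
  pos := P.pos
  len_pos := P.len_pos
  pos_nonneg k i := by
    have hL := P.len_pos k
    have hL' := P.len_pos (k + 1)
    have hi : (i : ℝ) + 1 ≤ P.D := by exact_mod_cast i.2
    unfold pos
    split_ifs with h h0
    · positivity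
    · have := P.len_succ_of_isGap_le h (P.len_le_one k)
      nlinarith
    · positivity
  pos_add_len_le k i := by
    have hL := P.len_pos k
    have hL' := P.len_pos (k + 1)
    have hi : (i : ℝ) + 1 ≤ P.D := by exact_mod_cast i.2
    have hD := P.two_le_D_real
    unfold pos
    split_ifs with h h0
    · have := P.len_succ_of_isGap_le h (P.len_le_one k)
      nlinarith
    · have := P.len_succ_of_isGap_le h (P.len_le_one k)
      have : (0 : ℝ) ≤ i := by positivity
      nlinarith
    · have h1 : P.D * P.len (k + 1) = P.len k := by
        rw [P.len_succ_of_not_isGap h, mul_div_cancel₀ _ P.D_pos.ne']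
      nlinarith
  len_le_dist k i j hij := by
    have hL := P.len_pos k
    have hL' := P.len_pos (k + 1)
    have hD := P.two_le_D_real
    have hmul : P.len (k + 1) ≤ |(i : ℝ) * P.len (k + 1) - j * P.len (k + 1)| := by
      rw [← sub_mul, abs_mul, abs_of_pos hL']
      have h1 : (1 : ℝ) ≤ |(i : ℝ) - j| := by
        have h2 : (1 : ℤ) ≤ |(i : ℤ) - (j : ℤ)| := by
          refine Int.one_le_abs fun h => hij (Fin.ext ?_)
          omega
        exact_mod_cast h2
      exact le_mul_of_one_le_left hL'.le h1
    have hgap : ∀ i : Fin P.D, P.IsGap k → P.len (k + 1) ≤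
        2 * (P.len k / 3) - i * P.len (k + 1) - (P.len k / 3 + P.len (k + 1)) := by
      intro i h
      have hi : (i : ℝ) + 1 ≤ P.D := by exact_mod_cast i.2
      have := P.len_succ_of_isGap_le h (P.len_le_one k)
      nlinarith
    unfold pos
    split_ifs with h hi hj hj
    · exact absurd (hi.trans hj.symm) hij
    · rw [abs_sub_comm]
      exact (hgap j h).trans (le_abs_self _)
    · exact (hgap i h).trans (le_abs_self _)
    · rw [sub_sub_sub_cancel_left, abs_sub_comm]
      exact hmul
    · exact hmul

lemma start_add_pos {k : ℕ} (ω : ℕ → Fin P.D) :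
    P.scheme.start (k + 1) ω = P.scheme.start k ω + P.pos k (ω k) :=
  P.scheme.start_succ k ω

/-- If an address continues with the digit `0` in a generation with gaps, then the annulus whose
outer radius is a third of the length of the interval contains all the other children, while the
ball contains nothing outside the interval. -/
lemma annulusCharged {η : ℝ} (hη : η ≤ 1 - (P.D : ℝ)⁻¹) {k : ℕ} (hk : P.IsGap k)
    {ω : ℕ → Fin P.D} (hω : ω k = 0) :
    AnnulusCharged P.scheme.measure (P.scheme.point ω) (P.len k / 3) (P.b / P.a) η := by
  have hD := P.D_pos
  have hD2 := P.two_le_D_real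
  have hL := P.len_pos k
  have hL' := P.len_pos (k + 1)
  have hle := P.len_succ_of_isGap_le hk (P.len_le_one k)
  have hr : (P.len k / 3) ^ (P.b / P.a) = 2 * P.D * P.len (k + 1) := by
    rw [P.len_succ_of_isGap hk, mul_div_cancel₀ _ (by positivity)]
  have h1 := P.scheme.start_le_point (k + 1) ω
  have h2 := P.scheme.point_le_start_add_len (k + 1) ω
  have hpos : P.pos k (ω k) = P.len k / 3 + P.len (k + 1) := by
    rw [pos, if_pos hk, if_pos hω]
  rw [P.start_add_pos, hpos] at h1 h2
  change _ ≤ _ + P.len (k + 1) at h2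
  -- The children `i ≠ 0` fill an interval of length `(D - 1) * len (k + 1)`, and the point lies up to
  -- `2 * len (k + 1)` beyond the first third: together less than the width `2 * D * len (k + 1)`.
  have hDL : 2 * P.len (k + 1) ≤ P.D * P.len (k + 1) := by gcongr
  have hball : P.scheme.measure (Metric.closedBall (P.scheme.point ω) (P.len k / 3))
      ≤ ENNReal.ofReal (((P.D : ℝ)⁻¹) ^ k) := by
    refine P.scheme.measure_le_of_subset_Ioo ω Metric.isClosed_closedBall.measurableSet ?_
    intro y hy
    rw [Metric.mem_closedBall, Real.dist_eq, abs_le] at hy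
    constructor
    · linarith
    · change y < _ + P.len k
      linarith
  have hann : ENNReal.ofReal ((1 - (P.D : ℝ)⁻¹) * ((P.D : ℝ)⁻¹) ^ k)
      ≤ P.scheme.measure (annulus (P.scheme.point ω) (P.len k / 3) (P.b / P.a)) := by
    refine P.scheme.le_measure_of_children_subset ω (Metric.isClosed_closedBall.measurableSet.diff
      Metric.isClosed_closedBall.measurableSet) fun i hi y hy => ?_
    have hpi : P.scheme.pos k i = 2 * (P.len k / 3) - i * P.len (k + 1) := by
      change P.pos k i = _
      rw [pos, if_pos hk, if_neg hi]
    have hi1 : (1 : ℝ) ≤ i := by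
      exact_mod_cast Nat.one_le_iff_ne_zero.2 fun h => hi (Fin.ext (by simpa using h))
    have hi2 : (i : ℝ) + 1 ≤ P.D := by exact_mod_cast i.2
    have hi3 : P.len (k + 1) ≤ i * P.len (k + 1) := le_mul_of_one_le_left hL'.le hi1
    have hi4 : i * P.len (k + 1) + P.len (k + 1) ≤ P.D * P.len (k + 1) := by
      have := mul_le_mul_of_nonneg_right hi2 hL'.le
      linarith
    obtain ⟨hy1, hy2⟩ := hy
    rw [hpi] at hy1 hy2
    change _ ≤ _ + _ + P.len (k + 1) at hy2
    refine ⟨?_, fun hy3 => ?_⟩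
    · rw [Metric.mem_closedBall, Real.dist_eq, abs_le]
      constructor <;> linarith
    · rw [Metric.mem_closedBall, Real.dist_eq, hr, abs_le] at hy3
      linarith [hy3.2]
  calc ENNReal.ofReal η * _
      ≤ ENNReal.ofReal (1 - (P.D : ℝ)⁻¹) * ENNReal.ofReal (((P.D : ℝ)⁻¹) ^ k) :=
        mul_le_mul' (ENNReal.ofReal_le_ofReal hη) hball
    _ = ENNReal.ofReal ((1 - (P.D : ℝ)⁻¹) * ((P.D : ℝ)⁻¹) ^ k) :=
        (ENNReal.ofReal_mul' (by positivity)).symm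
    _ ≤ _ := hann

lemma exists_len_lt_le {r : ℝ} (hr : 0 < r) (hr' : r ≤ P.l) :
    ∃ k, P.len (k + 1) < r ∧ r ≤ P.len k := by
  have hex : ∃ k, P.len k < r :=
    ((tendsto_nhdsWithin_iff.1 P.tendsto_len).1.eventually (gt_mem_nhds hr)).exists
  classical
  obtain ⟨m, hm⟩ : ∃ m, Nat.find hex = m + 1 := by
    refine Nat.exists_eq_succ_of_ne_zero fun h0 => ?_
    have := Nat.find_spec hex
    rw [h0] at this
    exact absurd hr' (not_le.2 this)
  refine ⟨m, hm ▸ Nat.find_spec hex, not_lt.1 (Nat.find_min hex (by omega))⟩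

lemma measure_closedBall_le {r : ℝ} (hr : 0 < r) (hr' : r ≤ P.l) (x : ℝ) :
    P.scheme.measure (Metric.closedBall x r)
      ≤ ENNReal.ofReal (4 * P.D * P.bound * r ^ P.a) := by
  obtain ⟨k, hk1, hk2⟩ := P.exists_len_lt_le hr hr'
  refine (P.scheme.measure_closedBall_le hk2 x).trans (ENNReal.ofReal_le_ofReal ?_)
  have hD := P.D_pos
  have h1 := P.mass_le (k + 1)
  have h2 : P.len (k + 1) ^ P.a ≤ r ^ P.a :=
    Real.rpow_le_rpow (P.len_pos _).le hk1.le P.a_pos.le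
  calc 4 * ((P.D : ℝ)⁻¹) ^ k = 4 * P.D * ((P.D : ℝ)⁻¹) ^ (k + 1) := by
        rw [pow_succ', mul_assoc, mul_inv_cancel_left₀ hD.ne']
    _ ≤ 4 * P.D * (P.bound * P.len (k + 1) ^ P.a) := by gcongr
    _ ≤ 4 * P.D * (P.bound * r ^ P.a) := by
        have := P.bound_pos
        gcongr
    _ = _ := by ring

/-- The lower power law at a point whose balls of radius `len k` have the mass of an interval of
generation `k`; this hypothesis holds almost everywhere and is visibly measurable in `x`. -/
lemma le_measure_closedBall {r : ℝ} (hr : 0 < r) (hr' : r ≤ P.l) {x : ℝ}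
    (hx : ∀ k, ENNReal.ofReal (((P.D : ℝ)⁻¹) ^ k)
      ≤ P.scheme.measure (Metric.closedBall x (P.len k))) :
    ENNReal.ofReal (((P.D : ℝ)⁻¹) ^ 2 * r ^ P.b)
      ≤ P.scheme.measure (Metric.closedBall x r) := by
  obtain ⟨k, hk1, hk2⟩ := P.exists_len_lt_le hr hr'
  refine le_trans (ENNReal.ofReal_le_ofReal ?_)
    ((hx (k + 1)).trans (measure_mono (Metric.closedBall_subset_closedBall hk1.le)))
  have hD := P.D_pos
  calc ((P.D : ℝ)⁻¹) ^ 2 * r ^ P.b ≤ ((P.D : ℝ)⁻¹) ^ 2 * P.len k ^ P.b := by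
        have := P.b_pos
        gcongr
    _ ≤ ((P.D : ℝ)⁻¹) ^ 2 * (P.D * ((P.D : ℝ)⁻¹) ^ k) := by
        gcongr
        exact P.len_rpow_b_le k
    _ = _ := by
        rw [pow_succ' _ k, sq, mul_assoc, inv_mul_cancel_left₀ hD.ne']

/-- Just after a gap the mass is comparable to the `a`-th power of the length, so that the exponent
`a` is attained. -/
lemma len_succ_rpow_a_le_mass {k : ℕ} (hk : P.IsGap k) :
    ((P.D : ℝ)⁻¹) ^ 2 * P.len (k + 1) ^ P.a ≤ ((P.D : ℝ)⁻¹) ^ (k + 1) := by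
  have hD := P.D_pos
  have hL := P.len_pos k
  have h1 : P.len (k + 1) ^ P.a ≤ P.len k ^ P.b := by
    rw [P.len_succ_rpow_a hk]
    refine (div_le_self (by positivity) ?_).trans ?_
    · exact Real.one_le_rpow (by linarith [P.two_le_D_real]) P.a_pos.le
    · exact Real.rpow_le_rpow (by positivity) (by linarith) P.b_pos.le
  calc _ ≤ ((P.D : ℝ)⁻¹) ^ 2 * (P.D * ((P.D : ℝ)⁻¹) ^ k) := by
        gcongr
        exact h1.trans (P.len_rpow_b_le k)
    _ = _ := by
        rw [pow_succ' _ k, sq, mul_assoc, inv_mul_cancel_left₀ hD.ne']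

end GapParams

lemma measurable_measure_closedBall (ν : Measure ℝ) [SFinite ν] (r : ℝ) :
    Measurable fun x => ν (Metric.closedBall x r) := by
  have h : MeasurableSet {p : ℝ × ℝ | dist p.2 p.1 ≤ r} :=
    measurableSet_le (measurable_snd.dist measurable_fst) measurable_const
  exact measurable_measure_prodMk_left h

lemma measurable_measure_annulus (ν : Measure ℝ) [SFinite ν] (r δ : ℝ) :
    Measurable fun x => ν (annulus x r δ) := by
  have h (s : ℝ) : MeasurableSet {p : ℝ × ℝ | dist p.2 p.1 ≤ s} :=
    measurableSet_le (measurable_snd.dist measurable_fst) measurable_const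
  exact measurable_measure_prodMk_left ((h r).diff (h (r - r ^ δ)))

/-- The one-dimensional case of the construction, with the power laws that determine the lower
dimension `a` and the upper dimension `b`. -/
lemma exists_measure_real {a b η : ℝ} (ha : 0 < a) (hab : a < b) (hb : b < 1) (hη : η < 1) :
    ∃ ν : Measure ℝ, IsProbabilityMeasure ν ∧ ∃ C c : ℝ, 0 < c ∧
      (∀ᵐ x ∂ν, ∀ᶠ r in 𝓝[>] (0 : ℝ), ν (Metric.closedBall x r) ≤ ENNReal.ofReal (C * r ^ a)) ∧
      (∀ᵐ x ∂ν, ∃ᶠ r in 𝓝[>] (0 : ℝ), ENNReal.ofReal (c * r ^ a) ≤ ν (Metric.closedBall x r)) ∧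
      (∀ᵐ x ∂ν, ∀ᶠ r in 𝓝[>] (0 : ℝ), ENNReal.ofReal (c * r ^ b) ≤ ν (Metric.closedBall x r)) ∧
      (∀ᵐ x ∂ν, ∃ᶠ r in 𝓝[>] (0 : ℝ), ν (Metric.closedBall x r) ≤ ENNReal.ofReal (4 * r ^ b)) ∧
      (∀ᵐ x ∂ν, ∃ᶠ r in 𝓝[>] (0 : ℝ), AnnulusCharged ν x r (b / a) η) := by
  -- The children other than the `0`-th carry the proportion `1 - 1 / D` of the mass.
  obtain ⟨D, hD2, hDη⟩ : ∃ D : ℕ, 2 ≤ D ∧ η ≤ 1 - (D : ℝ)⁻¹ := by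
    obtain ⟨m, hm⟩ := exists_nat_gt (1 - η)⁻¹
    refine ⟨m + 2, by omega, ?_⟩
    have h0 : 0 < (1 - η)⁻¹ := inv_pos.2 (by linarith)
    have h1 : (((m + 2 : ℕ) : ℝ))⁻¹ ≤ 1 - η := by
      rw [inv_le_comm₀ (by positivity) (by linarith)]
      push_cast
      linarith
    linarith
  obtain ⟨P, rfl, rfl, rfl⟩ := GapParams.exists_of_lt ha hab hb hD2
  have hl : ∀ᶠ r in 𝓝[>] (0 : ℝ), 0 < r ∧ r ≤ P.l := by
    filter_upwards [Ioo_mem_nhdsGT P.l_pos] with r hr using ⟨hr.1, hr.2.le⟩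
  have hcyl : ∀ᵐ x ∂P.scheme.measure, ∀ k, ENNReal.ofReal (((P.D : ℝ)⁻¹) ^ k)
      ≤ P.scheme.measure (Metric.closedBall x (P.len k)) := by
    rw [P.scheme.ae_measure_iff]
    · exact Eventually.of_forall fun ω k => P.scheme.le_measure_closedBall le_rfl ω
    · rw [ofPred_forall]
      exact MeasurableSet.iInter fun k =>
        measurableSet_le measurable_const (measurable_measure_closedBall _ _)
  have hD := P.D_pos
  refine ⟨P.scheme.measure, inferInstance, 4 * P.D * P.bound, ((P.D : ℝ)⁻¹) ^ 2, by positivity,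
    ?_, ?_, ?_, ?_, ?_⟩
  · refine Eventually.of_forall fun x => ?_
    filter_upwards [hl] with r hr using P.measure_closedBall_le hr.1 hr.2 x
  · filter_upwards [hcyl] with x hx
    refine (P.tendsto_len.comp (tendsto_add_atTop_nat 1)).frequently ?_
    exact P.frequently_isGap.mono fun k hk =>
      (ENNReal.ofReal_le_ofReal (P.len_succ_rpow_a_le_mass hk)).trans (hx (k + 1))
  · filter_upwards [hcyl] with x hx
    filter_upwards [hl] with r hr using P.le_measure_closedBall hr.1 hr.2 hx
  · refine Eventually.of_forall fun x => P.tendsto_len.frequently ?_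
    refine P.frequently_isGap.mono fun k hk =>
      (P.scheme.measure_closedBall_le le_rfl x).trans (ENNReal.ofReal_le_ofReal ?_)
    exact mul_le_mul_of_nonneg_left hk (by norm_num)
  · have hlen3 : Tendsto (fun k => P.len k / 3) atTop (𝓝[>] 0) := by
      obtain ⟨h1, h2⟩ := tendsto_nhdsWithin_iff.1 P.tendsto_len
      refine tendsto_nhdsWithin_iff.2 ⟨by simpa using h1.div_const 3, ?_⟩
      filter_upwards [h2] with k hk
      exact div_pos (mem_Ioi.1 hk) three_pos
    have h : ∀ᵐ x ∂P.scheme.measure, ∃ᶠ k in atTop,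
        AnnulusCharged P.scheme.measure x (P.len k / 3) (P.b / P.a) η := by
      rw [P.scheme.ae_measure_iff]
      · filter_upwards [frequently_digit_eq_zero P.frequently_isGap] with ω hω
        exact hω.mono fun k hk => P.annulusCharged hDη hk.1 hk.2
      · simp only [frequently_atTop, ofPred_forall, ofPred_exists]
        refine MeasurableSet.iInter fun N => MeasurableSet.iUnion fun k => ?_
        refine (MeasurableSet.const (k ≥ N)).inter ?_
        exact measurableSet_le ((measurable_measure_closedBall _ _).const_mul _)
          (measurable_measure_annulus _ _ _)
    filter_upwards [h] with x hx
    exact hlen3.frequently hx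

/-! ### Power laws and dimensions -/

section Dimension

variable {X : Type*} [MetricSpace X] [MeasurableSpace X] {μ : Measure X}

lemma exists_radius_iff_eventually (p : ℝ → Prop) :
    (∃ r₀ : ℝ, 0 < r₀ ∧ ∀ r : ℝ, 0 < r → r < r₀ → p r) ↔ ∀ᶠ r in 𝓝[>] (0 : ℝ), p r := by
  rw [Filter.Eventually, mem_nhdsGT_iff_exists_Ioo_subset]
  constructor
  · rintro ⟨r₀, h0, h⟩
    exact ⟨r₀, h0, fun r hr => h r hr.1 hr.2⟩
  · rintro ⟨r₀, h0, h⟩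
    exact ⟨r₀, h0, fun r hr hr' => h ⟨hr, hr'⟩⟩

lemma eventually_mul_rpow_lt_rpow (C : ℝ) {s t : ℝ} (h : s < t) :
    ∀ᶠ r in 𝓝[>] (0 : ℝ), C * r ^ t < r ^ s := by
  have h1 : Tendsto (fun r : ℝ => C * r ^ (t - s)) (𝓝[>] 0) (𝓝 0) := by
    have h2 : Tendsto (fun r : ℝ => C * r ^ (t - s)) (𝓝 0) (𝓝 (C * 0 ^ (t - s))) :=
      ((Real.continuousAt_rpow_const 0 (t - s) (Or.inr (by linarith))).tendsto).const_mul C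
    rw [Real.zero_rpow (by linarith), mul_zero] at h2
    exact h2.mono_left nhdsWithin_le_nhds
  filter_upwards [h1.eventually (gt_mem_nhds zero_lt_one), self_mem_nhdsWithin] with r hr hr0
  have hr0 : 0 < r := hr0
  have h3 : 0 < r ^ s := Real.rpow_pos_of_pos hr0 s
  calc C * r ^ t = C * r ^ (t - s) * r ^ s := by
        rw [mul_assoc, ← Real.rpow_add hr0, sub_add_cancel]
    _ < 1 * r ^ s := by gcongr
    _ = r ^ s := one_mul _

lemma lowerDim_eq [NeZero μ] {s C c : ℝ} (hs : 0 < s) (hc : 0 < c)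
    (h1 : ∀ᵐ x ∂μ, ∀ᶠ r in 𝓝[>] (0 : ℝ), μ (Metric.closedBall x r) ≤ ENNReal.ofReal (C * r ^ s))
    (h2 : ∀ᵐ x ∂μ, ∃ᶠ r in 𝓝[>] (0 : ℝ),
      ENNReal.ofReal (c * r ^ s) ≤ μ (Metric.closedBall x r)) :
    lowerDim μ = (s : EReal) := by
  unfold lowerDim
  simp only [exists_radius_iff_eventually]
  refine le_antisymm (sSup_le ?_) (le_of_forall_lt fun t ht => ?_)
  · rintro _ ⟨α, ⟨-, hα⟩, rfl⟩
    refine EReal.coe_le_coe_iff.2 (le_of_not_gt fun hsα => ?_)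
    obtain ⟨x, hx1, hx2⟩ := (hα.and h2).exists
    obtain ⟨r, hr2, hr1, hr3, hr0⟩ := (hx2.and_eventually (hx1.and
      ((eventually_mul_rpow_lt_rpow c⁻¹ hsα).and self_mem_nhdsWithin))).exists
    have hr0 : 0 < r := hr0
    have h4 := (ENNReal.ofReal_le_ofReal_iff (by positivity)).1 (hr2.trans hr1)
    rw [inv_mul_lt_iff₀ hc] at hr3
    linarith
  · obtain ⟨z, hz1, hz2⟩ := EReal.lt_iff_exists_real_btwn.1 ht
    have hz2 : z < s := EReal.coe_lt_coe_iff.1 hz2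
    have hz3 : max z 0 < s := max_lt hz2 hs
    refine lt_of_lt_of_le (hz1.trans_le (EReal.coe_le_coe_iff.2 (le_max_left z 0)))
      (le_sSup ⟨max z 0, ⟨le_max_right _ _, ?_⟩, rfl⟩)
    filter_upwards [h1] with x hx
    filter_upwards [hx, eventually_mul_rpow_lt_rpow C hz3] with r hr hr'
    exact hr.trans (ENNReal.ofReal_le_ofReal hr'.le)

lemma upperDim_eq [NeZero μ] {s C c : ℝ} (hs : 0 < s) (hc : 0 < c)
    (h1 : ∀ᵐ x ∂μ, ∀ᶠ r in 𝓝[>] (0 : ℝ), ENNReal.ofReal (c * r ^ s) ≤ μ (Metric.closedBall x r))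
    (h2 : ∀ᵐ x ∂μ, ∃ᶠ r in 𝓝[>] (0 : ℝ),
      μ (Metric.closedBall x r) ≤ ENNReal.ofReal (C * r ^ s)) :
    upperDim μ = (s : EReal) := by
  unfold upperDim
  simp only [exists_radius_iff_eventually]
  refine le_antisymm (le_of_forall_gt fun t ht => ?_) (le_sInf ?_)
  · obtain ⟨z, hz1, hz2⟩ := EReal.lt_iff_exists_real_btwn.1 ht
    have hz1 : s < z := EReal.coe_lt_coe_iff.1 hz1
    refine lt_of_le_of_lt (sInf_le ⟨z, ⟨(hs.trans hz1).le, ?_⟩, rfl⟩) hz2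
    filter_upwards [h1] with x hx
    filter_upwards [hx, eventually_mul_rpow_lt_rpow c⁻¹ hz1] with r hr hr'
    rw [inv_mul_lt_iff₀ hc] at hr'
    exact (ENNReal.ofReal_le_ofReal hr'.le).trans hr
  · rintro _ ⟨β, ⟨-, hβ⟩, rfl⟩
    refine EReal.coe_le_coe_iff.2 (le_of_not_gt fun hsβ => ?_)
    obtain ⟨x, hx1, hx2⟩ := (hβ.and h2).exists
    obtain ⟨r, hr2, hr1, hr3, hr0⟩ := (hx2.and_eventually (hx1.and
      ((eventually_mul_rpow_lt_rpow C hsβ).and self_mem_nhdsWithin))).exists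
    have hr0 : 0 < r := hr0
    have h4 := (ENNReal.ofReal_lt_ofReal_iff (Real.rpow_pos_of_pos hr0 β)).2 hr3
    exact absurd (hr1.trans hr2) (not_le.2 h4)

lemma mem_annulusSet_of_frequently {x : X} {δ η : ℝ}
    (h : ∃ᶠ r in 𝓝[>] (0 : ℝ), AnnulusCharged μ x r δ η) : x ∈ annulusSet μ δ η := by
  have h' := h.and_eventually (Ioo_mem_nhdsGT (zero_lt_one (α := ℝ)))
  obtain ⟨r, hr, hp⟩ := exists_seq_forall_of_frequently h'
  exact ⟨r, fun n => (hp n).2, tendsto_nhdsWithin_iff.1 hr |>.1, fun n => (hp n).1⟩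

end Dimension

/-! ### Products with the unit cube -/

section Product

/-- The product of a measure on the first coordinate axis with Lebesgue measure on the unit cube
of the remaining coordinates. -/
noncomputable def prodUnitCube (n : ℕ) (ν : Measure ℝ) : Measure (Fin (n + 1) → ℝ) :=
  Measure.pi (Fin.cons ν fun _ => volume.restrict (Icc 0 1))

instance (n : ℕ) (ν : Measure ℝ) [IsProbabilityMeasure ν] (i : Fin (n + 1)) :
    IsProbabilityMeasure (Fin.cons (α := fun _ => Measure ℝ) ν
      (fun _ => volume.restrict (Icc 0 1)) i) := by
  refine Fin.cases ?_ (fun j => ?_) i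
  · simpa
  · simp only [Fin.cons_succ]
    exact ⟨by simp⟩

instance (n : ℕ) (ν : Measure ℝ) [IsProbabilityMeasure ν] :
    IsProbabilityMeasure (prodUnitCube n ν) := by
  unfold prodUnitCube
  infer_instance

variable {n : ℕ} {ν : Measure ℝ} [IsProbabilityMeasure ν]

lemma prodUnitCube_pi (s : Fin (n + 1) → Set ℝ) :
    prodUnitCube n ν (Set.pi univ s)
      = ν (s 0) * ∏ i : Fin n, volume.restrict (Icc (0 : ℝ) 1) (s i.succ) := by
  rw [prodUnitCube, Measure.pi_pi, Fin.prod_univ_succ]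
  simp only [Fin.cons_zero, Fin.cons_succ]

lemma ae_prodUnitCube_of_ae {p : ℝ → Prop} (h : ∀ᵐ x ∂ν, p x) :
    ∀ᵐ x ∂(prodUnitCube n ν), p (x 0) := by
  have h0 : ∀ᵐ x ∂(Fin.cons (α := fun _ => Measure ℝ) ν
      (fun _ : Fin n => volume.restrict (Icc 0 1)) 0), p x := by simpa using h
  exact (Measure.tendsto_eval_ae_ae (i := 0)).eventually h0

lemma ae_prodUnitCube_mem_Icc :
    ∀ᵐ x ∂(prodUnitCube n ν), ∀ i : Fin n, x i.succ ∈ Icc (0 : ℝ) 1 := by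
  rw [ae_all_iff]
  intro i
  have h0 : ∀ᵐ x ∂(Fin.cons (α := fun _ => Measure ℝ) ν
      (fun _ : Fin n => volume.restrict (Icc 0 1)) i.succ), x ∈ Icc (0 : ℝ) 1 := by
    simpa using ae_restrict_mem (μ := volume) (measurableSet_Icc (a := (0 : ℝ)) (b := 1))
  exact (Measure.tendsto_eval_ae_ae (i := i.succ)).eventually h0

lemma volume_restrict_closedBall_le (x r : ℝ) :
    volume.restrict (Icc (0 : ℝ) 1) (Metric.closedBall x r) ≤ ENNReal.ofReal (2 * r) :=
  (Measure.restrict_le_self _).trans_eq (Real.volume_closedBall x r)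

lemma le_volume_restrict_closedBall {x r : ℝ} (hx : x ∈ Icc (0 : ℝ) 1) (hr0 : 0 ≤ r)
    (hr : r ≤ 1 / 2) :
    ENNReal.ofReal r ≤ volume.restrict (Icc (0 : ℝ) 1) (Metric.closedBall x r) := by
  rw [Measure.restrict_apply Metric.isClosed_closedBall.measurableSet, Real.closedBall_eq_Icc,
    Icc_inter_Icc, Real.volume_Icc]
  apply ENNReal.ofReal_le_ofReal
  obtain ⟨h0, h1⟩ := hx
  rcases le_total x (1 / 2) with h | h
  · have a1 : (x + r) ⊓ 1 = x + r := inf_eq_left.2 (by linarith)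
    have a2 : (x - r) ⊔ 0 ≤ x := sup_le (by linarith) h0
    linarith
  · have a1 : (x - r) ⊔ 0 = x - r := sup_eq_left.2 (by linarith)
    have a2 : x ≤ (x + r) ⊓ 1 := le_inf (by linarith) h1
    linarith

lemma prodUnitCube_closedBall {r : ℝ} (hr : 0 ≤ r) (x : Fin (n + 1) → ℝ) :
    prodUnitCube n ν (Metric.closedBall x r) = ν (Metric.closedBall (x 0) r) *
      ∏ i : Fin n, volume.restrict (Icc (0 : ℝ) 1) (Metric.closedBall (x i.succ) r) := by
  rw [closedBall_pi x hr, prodUnitCube_pi]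

lemma prodUnitCube_closedBall_le {r s C : ℝ} (hr : 0 < r) {x : Fin (n + 1) → ℝ}
    (h : ν (Metric.closedBall (x 0) r) ≤ ENNReal.ofReal (C * r ^ s)) :
    prodUnitCube n ν (Metric.closedBall x r) ≤ ENNReal.ofReal (C * 2 ^ n * r ^ (s + n)) := by
  rw [prodUnitCube_closedBall hr.le]
  calc _ ≤ ENNReal.ofReal (C * r ^ s) * ∏ _i : Fin n, ENNReal.ofReal (2 * r) :=
        mul_le_mul' h (Finset.prod_le_prod' fun i _ => volume_restrict_closedBall_le _ _)
    _ = _ := by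
        rw [Finset.prod_const, Finset.card_univ, Fintype.card_fin,
          ← ENNReal.ofReal_pow (by positivity), ← ENNReal.ofReal_mul' (by positivity),
          Real.rpow_add hr, Real.rpow_natCast, mul_pow]
        congr 1
        ring

lemma le_prodUnitCube_closedBall {r s C : ℝ} (hr : 0 < r) (hr' : r ≤ 1 / 2)
    {x : Fin (n + 1) → ℝ} (hx : ∀ i : Fin n, x i.succ ∈ Icc (0 : ℝ) 1)
    (h : ENNReal.ofReal (C * r ^ s) ≤ ν (Metric.closedBall (x 0) r)) :
    ENNReal.ofReal (C * r ^ (s + n)) ≤ prodUnitCube n ν (Metric.closedBall x r) := by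
  rw [prodUnitCube_closedBall hr.le]
  calc _ = ENNReal.ofReal (C * r ^ s) * ∏ _i : Fin n, ENNReal.ofReal r := by
        rw [Finset.prod_const, Finset.card_univ, Fintype.card_fin,
          ← ENNReal.ofReal_pow hr.le, ← ENNReal.ofReal_mul' (by positivity),
          Real.rpow_add hr, Real.rpow_natCast]
        congr 1
        ring
    _ ≤ _ := mul_le_mul' h
        (Finset.prod_le_prod' fun i _ => le_volume_restrict_closedBall (hx i) hr.le hr')

/-- In the sup norm, a point of the ball whose first coordinate lies in the one-dimensional annulus
lies in the annulus, so that the property of being charged is inherited from the first axis. -/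
lemma AnnulusCharged.prodUnitCube {r δ η : ℝ} (hr : 0 < r) {x : Fin (n + 1) → ℝ}
    (h : AnnulusCharged ν (x 0) r δ η) : AnnulusCharged (prodUnitCube n ν) x r δ η := by
  unfold AnnulusCharged at h ⊢
  have hsub : Set.pi univ (Fin.cons (α := fun _ => Set ℝ) (annulus (x 0) r δ)
      fun i : Fin n => Metric.closedBall (x i.succ) r) ⊆ annulus x r δ := by
    intro y hy
    have h0 := hy 0 (mem_univ _)
    rw [Fin.cons_zero] at h0
    refine ⟨?_, fun h1 => h0.2 ?_⟩
    · rw [closedBall_pi x hr.le]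
      intro i _
      refine Fin.cases h0.1 (fun j => ?_) i
      simpa only [Fin.cons_succ] using hy j.succ (mem_univ _)
    · rw [Metric.mem_closedBall] at h1 ⊢
      exact (dist_le_pi_dist y x 0).trans h1
  rw [prodUnitCube_closedBall hr.le, ← mul_assoc]
  refine le_trans ?_ (measure_mono hsub)
  rw [prodUnitCube_pi, Fin.cons_zero]
  simp only [Fin.cons_succ]
  gcongr

end Product

/-! ### The measure on `ℝᵈ` -/

theorem theorem2 (d : ℕ) (hd : 1 ≤ d) (dl du η : ℝ)
    (hdl : (d : ℝ) - 1 < dl) (hlu : dl < du) (hdu : du < (d : ℝ))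
    (hη0 : 0 < η) (hη1 : η < 1) :
    ∃ μ : Measure (Fin d → ℝ), IsProbabilityMeasure μ ∧
      lowerDim μ = (dl : EReal) ∧ upperDim μ = (du : EReal) ∧
      NullMeasurableSet
        (annulusSet μ ((du - ((d : ℝ) - 1)) / (dl - ((d : ℝ) - 1))) η) μ ∧
      μ (annulusSet μ ((du - ((d : ℝ) - 1)) / (dl - ((d : ℝ) - 1))) η) = 1 := by
  obtain ⟨n, rfl⟩ : ∃ n, d = n + 1 := ⟨d - 1, by omega⟩
  have hn : ((n + 1 : ℕ) : ℝ) - 1 = n := by push_cast; ring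
  rw [hn] at hdl ⊢
  push_cast at hdu
  have hn0 : (0 : ℝ) ≤ n := n.cast_nonneg
  obtain ⟨ν, hν, C, c, hc, h1, h2, h3, h4, h5⟩ :=
    exists_measure_real (a := dl - n) (b := du - n) (η := η) (by linarith) (by linarith)
      (by linarith) hη1
  have hr : ∀ᶠ r in 𝓝[>] (0 : ℝ), 0 < r ∧ r ≤ 1 / 2 := by
    filter_upwards [Ioo_mem_nhdsGT (show (0 : ℝ) < 1 / 2 by norm_num)] with r hr
      using ⟨hr.1, hr.2.le⟩
  have hae : ∀ᵐ x ∂(prodUnitCube n ν),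
      x ∈ annulusSet (prodUnitCube n ν) ((du - n) / (dl - n)) η := by
    filter_upwards [ae_prodUnitCube_of_ae h5] with x hx
    exact mem_annulusSet_of_frequently
      ((hx.and_eventually hr).mono fun r hr => hr.1.prodUnitCube hr.2.1)
  have huniv : annulusSet (prodUnitCube n ν) ((du - n) / (dl - n)) η =ᵐ[prodUnitCube n ν] univ :=
    eventuallyEq_univ.2 hae
  refine ⟨prodUnitCube n ν, inferInstance, ?_, ?_, ?_, ?_⟩
  · refine lowerDim_eq (C := C * 2 ^ n) (by linarith) hc ?_ ?_
    · filter_upwards [ae_prodUnitCube_of_ae h1] with x hx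
      filter_upwards [hx, hr] with r h hr
      simpa only [sub_add_cancel] using prodUnitCube_closedBall_le hr.1 h
    · filter_upwards [ae_prodUnitCube_of_ae h2, ae_prodUnitCube_mem_Icc] with x hx hx'
      refine (hx.and_eventually hr).mono fun r h => ?_
      simpa only [sub_add_cancel] using le_prodUnitCube_closedBall h.2.1 h.2.2 hx' h.1
  · refine upperDim_eq (C := 4 * 2 ^ n) (by linarith) hc ?_ ?_
    · filter_upwards [ae_prodUnitCube_of_ae h3, ae_prodUnitCube_mem_Icc] with x hx hx'
      filter_upwards [hx, hr] with r h hr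
      simpa only [sub_add_cancel] using le_prodUnitCube_closedBall hr.1 hr.2 hx' h
    · filter_upwards [ae_prodUnitCube_of_ae h4] with x hx
      refine (hx.and_eventually hr).mono fun r h => ?_
      simpa only [sub_add_cancel] using prodUnitCube_closedBall_le h.2.1 h.1
  · exact nullMeasurableSet_univ.congr huniv.symm
  · rw [measure_congr huniv, measure_univ]
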